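/- **Setting.** Fix the computational basis $\{|0\rangle,|1\rangle\}$ of $\mathbb C^2$ and the Pauli matrices $\sigma_x,\sigma_y,\sigma_z$. For a density matrix $\rho$ of one qubit let $\mathbf m(\rho)=(\mathrm{tr}(\sigma_x\rho),\mathrm{tr}(\sigma_y\rho))\in\mathbb R^2$ be the projection of its Bloch vector to the $xy$-plane. For two one-qubit states with $\mathbf m(\rho_1)\neq 0\neq\mathbf m(\rho_2)$ the quantum-phase fidelity is $$f(\rho_1,\rho_2)=\frac{\mathbf m(\rho_1)\cdot\mathbf m(\rho_2)}{\|\mathbf m(\rho_1)\|\,\|\mathbf m(\rho_2)\|};$$ otherwise it is undefined. For a two-qubit quantum channel $\Phi$ (a completely positive, trace-preserving linear map on $M_4(\mathbb C)$) and a two-qubit state $\rho$ the phase synchronization fidelity is $F(\rho,\Phi)=f(\mathrm{tr}_2\,\Phi(\rho),\mathrm{tr}_1\,\Phi(\rho))$, defined whenever the right-hand side is. Quantum-phase synchronization (QPS) is *perfect* for $\Phi$ and a set $\mathcal A$ of initial states if $F(\rho,\Phi)=1$ for every $\rho\in\mathcal A$ for which $F(\rho,\Phi)$ is defined. **Theorem.**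 For every $U\in SU(4)$, QPS is not perfect for the unitary channel $\Phi_U:\rho\mapsto U\rho U^\dagger$ and the set of all pure product states $|\psi_1\rangle\langle\psi_1|\otimes|\psi_2\rangle\langle\psi_2|$ of two qubits. That is, for every $U\in SU(4)$ there is a pure product state $\rho$ of two qubits for which $F(\rho,\Phi_U)$ is defined and $F(\rho,\Phi_U)\neq 1$. -/

import Mathlib

open scoped Matrix Kronecker ComplexOrder

noncomputable section

namespace QPS

/-- Operators on one qubit, written in the fixed computational basis. -/
abbrev QubitOp : Type := Matrix (Fin 2) (Fin 2) ℂ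

/-- Operators on two qubits; `(i, j)` stands for the basis vector `|i⟩ ⊗ |j⟩`. -/
abbrev TwoQubitOp : Type := Matrix (Fin 2 × Fin 2) (Fin 2 × Fin 2) ℂ

/-- The Pauli matrices `σ_x, σ_y, σ_z`, indexed by `0, 1, 2`. -/
def pauli : Fin 3 → QubitOp :=
  ![!![0, 1; 1, 0], !![0, -Complex.I; Complex.I, 0], !![1, 0; 0, -1]]

/-- The Bloch vector `n` of a density matrix `ρ = (1 + n · σ) / 2`, that is `n_i = tr (σ_i ρ)`. -/
def blochVector (ρ : QubitOp) : EuclideanSpace ℝ (Fin 3) :=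
  WithLp.toLp 2 fun i => (Matrix.trace (pauli i * ρ)).re

/-- The projection `m = (n_x, n_y)` of the Bloch vector to the `xy` plane. -/
def blochXY (ρ : QubitOp) : EuclideanSpace ℝ (Fin 2) :=
  !₂[blochVector ρ 0, blochVector ρ 1]

/-- The quantum-phase fidelity `m₁ · m₂ / (‖m₁‖ ‖m₂‖)`; meaningful only when both `m₁` and `m₂`
are nonzero, see `PhaseDefined`. -/
def phaseFidelity (ρ₁ ρ₂ : QubitOp) : ℝ :=
  inner ℝ (blochXY ρ₁) (blochXY ρ₂) / (‖blochXY ρ₁‖ * ‖blochXY ρ₂‖)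

/-- The quantum-phase fidelity of the two states is defined. -/
def PhaseDefined (ρ₁ ρ₂ : QubitOp) : Prop :=
  ‖blochXY ρ₁‖ ≠ 0 ∧ ‖blochXY ρ₂‖ ≠ 0

/-- The reduced state `tr₂ ρ` of qubit 1. -/
def reduced₁ (ρ : TwoQubitOp) : QubitOp :=
  Matrix.of fun i i' => ∑ j, ρ (i, j) (i', j)

/-- The reduced state `tr₁ ρ` of qubit 2. -/
def reduced₂ (ρ : TwoQubitOp) : QubitOp :=
  Matrix.of fun j j' => ∑ i, ρ (i, j) (i, j')

/-- The map `id_k ⊗ Φ`, acting on block matrices block by block. -/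
def amplify (k : ℕ) (Φ : TwoQubitOp →ₗ[ℂ] TwoQubitOp)
    (X : Matrix (Fin k × (Fin 2 × Fin 2)) (Fin k × (Fin 2 × Fin 2)) ℂ) :
    Matrix (Fin k × (Fin 2 × Fin 2)) (Fin k × (Fin 2 × Fin 2)) ℂ :=
  Matrix.of fun p q => Φ (Matrix.of fun i j => X (p.1, i) (q.1, j)) p.2 q.2

/-- A two-qubit quantum channel: a completely positive, trace-preserving linear map. -/
structure TwoQubitChannel where
  /-- the underlying linear map -/
  toFun : TwoQubitOp →ₗ[ℂ] TwoQubitOp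
  completelyPositive : ∀ (k : ℕ)
    (X : Matrix (Fin k × (Fin 2 × Fin 2)) (Fin k × (Fin 2 × Fin 2)) ℂ),
    X.PosSemidef → (amplify k toFun X).PosSemidef
  tracePreserving : ∀ X : TwoQubitOp, (toFun X).trace = X.trace

/-- The phase synchronization fidelity `F(ρ, Φ)`; meaningful only when `PSFDefined ρ Φ`. -/
def PSF (ρ : TwoQubitOp) (Φ : TwoQubitChannel) : ℝ :=
  phaseFidelity (reduced₁ (Φ.toFun ρ)) (reduced₂ (Φ.toFun ρ))

/-- `F(ρ, Φ)` is defined. -/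
def PSFDefined (ρ : TwoQubitOp) (Φ : TwoQubitChannel) : Prop :=
  PhaseDefined (reduced₁ (Φ.toFun ρ)) (reduced₂ (Φ.toFun ρ))

/-- Quantum-phase synchronization is perfect for the channel `Φ` and the set `A` of initial
states. -/
def PerfectQPS (Φ : TwoQubitChannel) (A : Set TwoQubitOp) : Prop :=
  ∀ ρ ∈ A, PSFDefined ρ Φ → PSF ρ Φ = 1

/-- A pure state `|ψ⟩⟨ψ|` of one qubit, with `⟨ψ|ψ⟩ = 1`. -/
def IsPureState (ρ : QubitOp) : Prop :=
  ∃ ψ : Fin 2 → ℂ, star ψ ⬝ᵥ ψ = 1 ∧ ρ = Matrix.vecMulVec ψ (star ψ)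

/-- The set of pure product states `|ψ₁⟩⟨ψ₁| ⊗ |ψ₂⟩⟨ψ₂|` of two qubits. -/
def pureProductStates : Set TwoQubitOp :=
  {ρ | ∃ ρ₁ ρ₂ : QubitOp, IsPureState ρ₁ ∧ IsPureState ρ₂ ∧ ρ = ρ₁ ⊗ₖ ρ₂}

/-- The linear map `ρ ↦ U ρ U†`. -/
def conjMap (U : TwoQubitOp) : TwoQubitOp →ₗ[ℂ] TwoQubitOp where
  toFun ρ := U * ρ * Uᴴ
  map_add' ρ τ := by rw [mul_add, add_mul]
  map_smul' c ρ := by simp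

theorem amplify_conjMap (k : ℕ) (U : TwoQubitOp)
    (X : Matrix (Fin k × (Fin 2 × Fin 2)) (Fin k × (Fin 2 × Fin 2)) ℂ) :
    amplify k (conjMap U) X =
      ((1 : Matrix (Fin k) (Fin k) ℂ) ⊗ₖ U) * X * ((1 : Matrix (Fin k) (Fin k) ℂ) ⊗ₖ U)ᴴ := by
  ext ⟨a, i⟩ ⟨b, j⟩
  have e₁ : ∀ x : Fin k × (Fin 2 × Fin 2),
      (((1 : Matrix (Fin k) (Fin k) ℂ) ⊗ₖ U) * X) (a, i) x = ∑ y, U i y * X (a, y) x := by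
    intro x
    simp [Matrix.mul_apply, Fintype.sum_prod_type_right, Matrix.one_apply]
  rw [Matrix.mul_apply]
  simp only [e₁]
  rw [Fintype.sum_prod_type_right]
  simp [amplify, conjMap, Matrix.mul_apply, Matrix.one_apply, apply_ite (starRingEnd ℂ)]

/-- The unitary channel `Φ_U : ρ ↦ U ρ U†`. -/
def unitaryChannel (U : Matrix.unitaryGroup (Fin 2 × Fin 2) ℂ) : TwoQubitChannel where
  toFun := conjMap U
  completelyPositive k X hX := by
    rw [amplify_conjMap]
    exact hX.mul_mul_conjTranspose_same _
  tracePreserving X := by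
    have h : (U : TwoQubitOp)ᴴ * (U : TwoQubitOp) = 1 := Matrix.UnitaryGroup.star_mul_self U
    change ((U : TwoQubitOp) * X * (U : TwoQubitOp)ᴴ).trace = X.trace
    rw [Matrix.trace_mul_comm, ← mul_assoc, h, one_mul]

end QPS

end

/-!
The coherences of the two output qubits are the expectations, in the input product vector, of
`A = Uᴴ (|1⟩⟨0| ⊗ 1) U` and `B = Uᴴ (1 ⊗ |1⟩⟨0|) U`. If synchronization were perfect, these two
complex numbers would have a real ratio (or one of them would vanish) on every product state; the
positivity of the ratio is not needed. The contradiction is derived from `A² = 0`, `A Bᴴ = Bᴴ A`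
and `A Bᴴ ≠ 0`.

On the product vector of `z`, the expectation of `A` is a polynomial `a` in ket variables `zᵢ` and
bra variables `z̄ᵢ`, of degree at most one in each, and real ratio means `a b* = a* b`, where `*`
conjugates coefficients and exchanges bra with ket (`conjSwap`). The points at which bra and ket
variables are conjugate are Zariski dense (`eq_zero_of_eval_conj_eq_zero`), so this identity holds
in the polynomial ring, which is factorial. Write `a = g p` and `b = g q` with `p`, `q` coprime.
Then `p q* = p* q` forces `p*` and `q*` to be constant multiples of `p` and `q`
(`exists_conjSwap_eq_C_mul`), so that a bra variable occurs in `p` or `q` exactly when its ket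
variable does. As `a` and `b` have degree at most one in each variable, neither then occurs in `g`.
Hence the qubits split into those of `p, q` and those of `g`, and `A = P ⊗ G`, `B = Q ⊗ G` with
`Pᴴ` proportional to `P` (`exists_kronecker_of_real_ratio`).

Now `A² = 0` gives `P² = 0` or `G² = 0`. The first makes `P Pᴴ` vanish, hence `P`. In the second
case, multiplying `P Qᴴ ⊗ G Gᴴ = Qᴴ P ⊗ Gᴴ G` by `1 ⊗ G` on the right gives
`P Qᴴ ⊗ G Gᴴ G = 0`. Either way `A Bᴴ = 0` (`kronecker_mul_conjTranspose_eq_zero`).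
-/

namespace QPS

/-! ### Kronecker products with a common factor -/

section Kronecker

variable {m n R : Type*}

theorem kronecker_eq_zero_iff [MulZeroClass R] [NoZeroDivisors R]
    {P : Matrix m m R} {G : Matrix n n R} : P ⊗ₖ G = 0 ↔ P = 0 ∨ G = 0 := by
  constructor
  · intro h
    by_contra! hPG
    obtain ⟨i, j, hP⟩ : ∃ i j, P i j ≠ 0 := by
      by_contra! h'
      exact hPG.1 (Matrix.ext h')
    obtain ⟨k, l, hG⟩ : ∃ k l, G k l ≠ 0 := by
      by_contra! h'
      exact hPG.2 (Matrix.ext h')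
    exact mul_ne_zero hP hG (congrFun (congrFun h (i, k)) (j, l))
  · rintro (rfl | rfl)
    · exact Matrix.zero_kronecker _
    · exact Matrix.kronecker_zero _

variable [Fintype m] [Fintype n]

/-- If `P ⊗ G` squares to zero and `P ≠ 0` is Hermitian up to a scalar, then the common factor `G`
squares to zero, and commutation of `P ⊗ G` with `(Q ⊗ G)ᴴ` forces `P Qᴴ = 0` or `G = 0`. -/
theorem kronecker_mul_conjTranspose_eq_zero {P Q : Matrix m m ℂ} {G : Matrix n n ℂ} {c : ℂ}
    (hP : Pᴴ = c • P) (hsq : (P ⊗ₖ G) * (P ⊗ₖ G) = 0)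
    (hcomm : (P ⊗ₖ G) * (Q ⊗ₖ G)ᴴ = (Q ⊗ₖ G)ᴴ * (P ⊗ₖ G)) :
    (P ⊗ₖ G) * (Q ⊗ₖ G)ᴴ = 0 := by
  classical
  simp only [Matrix.conjTranspose_kronecker, ← Matrix.mul_kronecker_mul] at hsq hcomm ⊢
  rw [kronecker_eq_zero_iff] at hsq ⊢
  rcases hsq with hPP | hGG
  · have : P * Pᴴ = 0 := by rw [hP, Matrix.mul_smul, hPP, smul_zero]
    rw [Matrix.self_mul_conjTranspose_eq_zero] at this
    exact Or.inl (by rw [this, zero_mul])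
  · have h := congrArg (· * ((1 : Matrix m m ℂ) ⊗ₖ G)) hcomm
    simp only [← Matrix.mul_kronecker_mul, mul_one] at h
    rw [mul_assoc Gᴴ, hGG, mul_zero, Matrix.kronecker_zero, kronecker_eq_zero_iff] at h
    refine h.imp_right fun h => ?_
    have : (Gᴴ * G)ᴴ * (Gᴴ * G) = 0 := by
      rw [Matrix.conjTranspose_mul, Matrix.conjTranspose_conjTranspose, mul_assoc,
        ← mul_assoc G, h, mul_zero]
    rw [Matrix.conjTranspose_mul_self_eq_zero, Matrix.conjTranspose_mul_self_eq_zero] at this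
    rw [this, zero_mul]

end Kronecker

/-! ### Polynomials in bra and ket variables -/

section Polynomial

open MvPolynomial

variable {ι : Type*}

/-- The involution of the polynomial ring in bra variables `inl i` and ket variables `inr i` that
conjugates the coefficients and exchanges bra and ket. It corresponds to the adjoint of
matrices. -/
noncomputable def conjSwap : MvPolynomial (ι ⊕ ι) ℂ →+* MvPolynomial (ι ⊕ ι) ℂ :=
  (rename (R := ℂ) Sum.swap).toRingHom.comp (map (starRingEnd ℂ))

theorem conjSwap_apply (p : MvPolynomial (ι ⊕ ι) ℂ) :
    conjSwap p = rename Sum.swap (map (starRingEnd ℂ) p) := rfl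

theorem conjSwap_monomial (d : ι ⊕ ι →₀ ℕ) (a : ℂ) :
    conjSwap (monomial d a) = monomial (d.mapDomain Sum.swap) (starRingEnd ℂ a) := by
  rw [conjSwap_apply, map_monomial, rename_monomial]

theorem conjSwap_conjSwap (p : MvPolynomial (ι ⊕ ι) ℂ) : conjSwap (conjSwap p) = p := by
  rw [conjSwap_apply, conjSwap_apply, map_rename, map_map, rename_rename]
  have : (starRingEnd ℂ).comp (starRingEnd ℂ) = RingHom.id ℂ := by ext; simp
  rw [this, map_id]
  simp

theorem conjSwap_ne_zero {p : MvPolynomial (ι ⊕ ι) ℂ} (hp : p ≠ 0) : conjSwap p ≠ 0 := by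
  intro h
  rw [← conjSwap_conjSwap p, h, map_zero] at hp
  exact hp rfl

theorem isRelPrime_conjSwap {p q : MvPolynomial (ι ⊕ ι) ℂ} (h : IsRelPrime p q) :
    IsRelPrime (conjSwap p) (conjSwap q) := by
  intro d hp hq
  have hp' := map_dvd conjSwap hp
  have hq' := map_dvd conjSwap hq
  rw [conjSwap_conjSwap] at hp' hq'
  have := (h hp' hq').map conjSwap
  rwa [conjSwap_conjSwap] at this

theorem degreeOf_conjSwap (p : MvPolynomial (ι ⊕ ι) ℂ) (i : ι ⊕ ι) :
    degreeOf i.swap (conjSwap p) = degreeOf i p := by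
  classical
  rw [conjSwap_apply, degreeOf_rename_of_injective Sum.swap_leftInverse.injective,
    degreeOf_eq_sup, degreeOf_eq_sup, support_map_of_injective _ (starRingEnd ℂ).injective]

/-- A coprime pair `p, q` whose quotient is fixed by the involution consists of polynomials which
are themselves fixed up to constants: `p` divides `p* q = p q*`, hence `p*`, and conversely. -/
theorem exists_conjSwap_eq_C_mul {p q : MvPolynomial (ι ⊕ ι) ℂ}
    (hpq : IsRelPrime p q) (h : p * conjSwap q = conjSwap p * q) :
    ∃ c : ℂ, c ≠ 0 ∧ conjSwap p = C c * p := by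
  have h₁ : p ∣ conjSwap p := hpq.dvd_of_dvd_mul_right ⟨_, h.symm⟩
  have h₂ : conjSwap p ∣ p := (isRelPrime_conjSwap hpq).dvd_of_dvd_mul_right ⟨_, h⟩
  obtain ⟨u, hu⟩ := associated_of_dvd_dvd h₁ h₂
  obtain ⟨c, hc, hcu⟩ := isUnit_iff_eq_C_of_isReduced.1 u.isUnit
  exact ⟨c, hc.ne_zero, by rw [← hu, hcu, mul_comm]⟩

theorem degreeOf_swap_of_conjSwap_eq_C_mul {p : MvPolynomial (ι ⊕ ι) ℂ} {c : ℂ} (hc : c ≠ 0)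
    (hp : p ≠ 0) (h : conjSwap p = C c * p) (i : ι ⊕ ι) : degreeOf i.swap p = degreeOf i p := by
  rw [← degreeOf_conjSwap p i, h, degreeOf_mul_eq (by simpa using hc) hp, degreeOf_C, zero_add]

/-- The coefficients of a product of two polynomials in disjoint sets of variables. -/
theorem coeff_mul_of_disjoint_variables {σ R : Type*} [CommSemiring R] (s : σ → Prop)
    [DecidablePred s] {p g : MvPolynomial σ R}
    (hp : ∀ i, ¬ s i → degreeOf i p = 0) (hg : ∀ i, s i → degreeOf i g = 0) (d : σ →₀ ℕ) :
    coeff d (p * g) = coeff (d.filter s) p * coeff (d.filter fun i => ¬ s i) g := by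
  classical
  rw [coeff_mul, Finset.sum_eq_single (d.filter s, d.filter fun i => ¬ s i)]
  · rintro ⟨x, y⟩ hxy hne
    obtain rfl := Finset.HasAntidiagonal.mem_antidiagonal.1 hxy
    by_contra h0
    have hx : ∀ i, ¬ s i → x i = 0 := fun i hi => Nat.le_zero.1 <| hp i hi ▸
      monomial_le_degreeOf i (mem_support_iff.2 (left_ne_zero_of_mul h0))
    have hy : ∀ i, s i → y i = 0 := fun i hi => Nat.le_zero.1 <| hg i hi ▸
      monomial_le_degreeOf i (mem_support_iff.2 (right_ne_zero_of_mul h0))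
    refine hne (Prod.ext ?_ ?_) <;> ext i <;> by_cases hs : s i <;> simp [hs, hx, hy]
  · intro h
    exact absurd (Finset.HasAntidiagonal.mem_antidiagonal.2 (Finsupp.filter_add_filter_not d s)) h

/-- The points whose bra coordinates are conjugate to their ket coordinates are Zariski dense:
after the change of variables `z = x + i y`, `z̄ = x - i y` they become the real points. -/
theorem eq_zero_of_eval_conj_eq_zero {p : MvPolynomial (ι ⊕ ι) ℂ}
    (h : ∀ z : ι → ℂ, eval (Sum.elim (star z) z) p = 0) : p = 0 := by
  let L : ι ⊕ ι → MvPolynomial (ι ⊕ ι) ℂ :=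
    Sum.elim (fun i => X (Sum.inl i) - C Complex.I * X (Sum.inr i))
      (fun i => X (Sum.inl i) + C Complex.I * X (Sum.inr i))
  have hL : ∀ w : ι ⊕ ι → ℂ, eval w (bind₁ L p) = eval (fun i => eval w (L i)) p := fun w => by
    simpa [coe_aeval_eq_eval] using aeval_bind₁ (R := ℂ) w L p
  have h0 : bind₁ L p = 0 := by
    refine funext_set (fun _ => Set.range ((↑) : ℝ → ℂ))
      (fun _ => Set.infinite_range_of_injective Complex.ofReal_injective) fun w hw => ?_
    choose r hr using fun i => hw i (Set.mem_univ i)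
    rw [map_zero, hL, ← h fun i => r (Sum.inl i) + Complex.I * r (Sum.inr i)]
    congr 1
    refine congrArg eval (funext fun i => ?_)
    rcases i with i | i <;> simp [L, ← hr, sub_eq_add_neg]
  refine MvPolynomial.funext fun w => ?_
  have := hL (Sum.elim (fun i => (w (Sum.inr i) + w (Sum.inl i)) / 2)
    (fun i => (w (Sum.inr i) - w (Sum.inl i)) / (2 * Complex.I)))
  rw [h0, map_zero] at this
  rw [map_zero, this]
  refine congrArg (fun v => eval v p) (funext fun i => ?_)
  have hI := Complex.I_ne_zero
  rcases i with i | i <;> simp [L] <;> field_simp <;> ring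

end Polynomial

/-! ### The polynomial of a matrix -/

section MatrixPolynomial

open MvPolynomial

variable {ι : Type*}

/-- The exponent vector of the monomial `z̄ ^ b * z ^ k`, for bit strings `b` and `k`. -/
noncomputable def bitExponent [Finite ι] (b k : ι → Fin 2) : ι ⊕ ι →₀ ℕ :=
  Finsupp.equivFunOnFinite.symm (Sum.elim (fun i => (b i : ℕ)) (fun i => (k i : ℕ)))

section Finite

variable [Finite ι]

@[simp] theorem bitExponent_inl (b k : ι → Fin 2) (i : ι) :
    bitExponent b k (Sum.inl i) = b i := rfl

@[simp] theorem bitExponent_inr (b k : ι → Fin 2) (i : ι) :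
    bitExponent b k (Sum.inr i) = k i := rfl

theorem bitExponent_inj {b k b' k' : ι → Fin 2} :
    bitExponent b k = bitExponent b' k' ↔ b = b' ∧ k = k' := by
  refine ⟨fun h => ⟨funext fun i => Fin.ext ?_, funext fun i => Fin.ext ?_⟩, ?_⟩
  · exact DFunLike.congr_fun h (Sum.inl i)
  · exact DFunLike.congr_fun h (Sum.inr i)
  · rintro ⟨rfl, rfl⟩; rfl

theorem mapDomain_swap_bitExponent (b k : ι → Fin 2) :
    (bitExponent b k).mapDomain Sum.swap = bitExponent k b := by
  ext i
  obtain ⟨i, rfl⟩ := Sum.swap_rightInverse.surjective i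
  rw [Finsupp.mapDomain_apply Sum.swap_leftInverse.injective]
  rcases i with i | i <;> rfl

theorem coeff_bitExponent_conjSwap (p : MvPolynomial (ι ⊕ ι) ℂ) (b k : ι → Fin 2) :
    coeff (bitExponent b k) (conjSwap p) = star (coeff (bitExponent k b) p) := by
  rw [conjSwap_apply, ← mapDomain_swap_bitExponent,
    coeff_rename_mapDomain _ Sum.swap_leftInverse.injective, coeff_map]
  rfl

end Finite

/-- The unnormalized product vector `⨂ᵢ (|0⟩ + zᵢ |1⟩)`. -/
def productVector [Fintype ι] (z : ι → ℂ) : (ι → Fin 2) → ℂ :=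
  fun b => ∏ i, z i ^ (b i : ℕ)

variable [Fintype ι] [DecidableEq ι]

/-- The polynomial, affine in each variable, whose coefficients are the entries of `A`. Its value
at `z̄, z` is the quadratic form of `A` at the product vector of `z`. -/
noncomputable def matrixPoly (A : Matrix (ι → Fin 2) (ι → Fin 2) ℂ) : MvPolynomial (ι ⊕ ι) ℂ :=
  ∑ b, ∑ k, monomial (bitExponent b k) (A b k)

variable (A B : Matrix (ι → Fin 2) (ι → Fin 2) ℂ)

theorem coeff_matrixPoly (b k : ι → Fin 2) :
    coeff (bitExponent b k) (matrixPoly A) = A b k := by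
  simp only [matrixPoly, coeff_sum, coeff_monomial, bitExponent_inj]
  rw [Finset.sum_eq_single b, Finset.sum_eq_single k] <;> simp +contextual

theorem matrixPoly_ne_zero {A : Matrix (ι → Fin 2) (ι → Fin 2) ℂ} (hA : A ≠ 0) :
    matrixPoly A ≠ 0 := by
  intro h
  refine hA (Matrix.ext fun b k => ?_)
  rw [← coeff_matrixPoly A, h, coeff_zero, Matrix.zero_apply]

theorem conjSwap_matrixPoly : conjSwap (matrixPoly A) = matrixPoly Aᴴ := by
  simp only [matrixPoly, map_sum, conjSwap_monomial, mapDomain_swap_bitExponent]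
  rw [Finset.sum_comm]
  rfl

theorem degreeOf_matrixPoly_le (i : ι ⊕ ι) : degreeOf i (matrixPoly A) ≤ 1 := by
  classical
  rw [degreeOf_le_iff]
  intro m hm
  obtain ⟨b, -, hm⟩ := Finset.mem_biUnion.1 (support_sum hm)
  obtain ⟨k, -, hm⟩ := Finset.mem_biUnion.1 (support_sum hm)
  rw [Finset.mem_singleton.1 (support_monomial_subset hm)]
  rcases i with i | i <;> simp <;> omega

theorem eval_matrixPoly (z : ι → ℂ) :
    eval (Sum.elim (star z) z) (matrixPoly A) =
      star (productVector z) ⬝ᵥ (A *ᵥ productVector z) := by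
  simp only [matrixPoly, map_sum, eval_monomial, dotProduct, Matrix.mulVec, Finset.mul_sum]
  refine Finset.sum_congr rfl fun b _ => Finset.sum_congr rfl fun k _ => ?_
  rw [Finsupp.prod_fintype _ _ (by simp), Fintype.prod_sum_type]
  simp only [bitExponent_inl, bitExponent_inr, Sum.elim_inl, Sum.elim_inr, productVector,
    Pi.star_apply, star_prod, star_pow]
  ring

/-- If the expectations of `A` and `B` in every product vector have a real ratio, then every
qubit is either of a Hermitian kind or of a common kind: over the former `A` and `B` are given by
matrices `P` and `Q`, `P` being Hermitian up to a scalar, over the latter by the same matrix `G`.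
This is the factorization of the polynomials of `A` and `B` into their greatest common divisor,
which gives `G`, and the coprime cofactors, which give `P` and `Q`. -/
theorem exists_kronecker_of_real_ratio {A B : Matrix (ι → Fin 2) (ι → Fin 2) ℂ}
    (hA : A ≠ 0) (hB : B ≠ 0)
    (h : ∀ z : ι → ℂ,
      (star (productVector z) ⬝ᵥ (A *ᵥ productVector z)) *
          (star (productVector z) ⬝ᵥ (Bᴴ *ᵥ productVector z)) =
        (star (productVector z) ⬝ᵥ (Aᴴ *ᵥ productVector z)) *
          (star (productVector z) ⬝ᵥ (B *ᵥ productVector z))) :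
    ∃ (s : ι → Prop) (_ : DecidablePred s)
      (P Q : Matrix ({i // s i} → Fin 2) ({i // s i} → Fin 2) ℂ)
      (G : Matrix ({i // ¬ s i} → Fin 2) ({i // ¬ s i} → Fin 2) ℂ) (c : ℂ),
      Pᴴ = c • P ∧
      A = (P ⊗ₖ G).submatrix (Equiv.piEquivPiSubtypeProd s fun _ => Fin 2)
        (Equiv.piEquivPiSubtypeProd s fun _ => Fin 2) ∧
      B = (Q ⊗ₖ G).submatrix (Equiv.piEquivPiSubtypeProd s fun _ => Fin 2)
        (Equiv.piEquivPiSubtypeProd s fun _ => Fin 2) := by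
  classical
  have hpoly : matrixPoly A * conjSwap (matrixPoly B) =
      conjSwap (matrixPoly A) * matrixPoly B := by
    rw [← sub_eq_zero]
    refine eq_zero_of_eval_conj_eq_zero fun z => ?_
    simp only [conjSwap_matrixPoly, map_sub, map_mul, eval_matrixPoly, h, sub_self]
  have hA' := matrixPoly_ne_zero hA
  have hB' := matrixPoly_ne_zero hB
  obtain ⟨p, q, g, hpq, hgp, hgq⟩ :=
    UniqueFactorizationMonoid.exists_reduced_factors (matrixPoly A) hA' (matrixPoly B)
  have hg0 : g ≠ 0 := by rintro rfl; exact hA' (by rw [← hgp, zero_mul])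
  have hp0 : p ≠ 0 := by rintro rfl; exact hA' (by rw [← hgp, mul_zero])
  have hq0 : q ≠ 0 := by rintro rfl; exact hB' (by rw [← hgq, mul_zero])
  have hcross : p * conjSwap q = conjSwap p * q := by
    refine mul_left_cancel₀ (mul_ne_zero hg0 (conjSwap_ne_zero hg0)) ?_
    rw [← hgp, ← hgq, map_mul, map_mul] at hpoly
    linear_combination hpoly
  obtain ⟨c, hc, hpc⟩ := exists_conjSwap_eq_C_mul hpq hcross
  obtain ⟨c', hc', hqc⟩ :=
    exists_conjSwap_eq_C_mul hpq.symm (by linear_combination -hcross)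
  have hpdeg := degreeOf_swap_of_conjSwap_eq_C_mul hc hp0 hpc
  have hqdeg := degreeOf_swap_of_conjSwap_eq_C_mul hc' hq0 hqc
  -- The qubits of the Hermitian kind are those whose variables occur in `p` or `q`.
  let s : ι → Prop := fun i => degreeOf (Sum.inl i) p ≠ 0 ∨ degreeOf (Sum.inl i) q ≠ 0
  let t : ι ⊕ ι → Prop := Sum.elim s s
  have ht : ∀ i, t i ↔ degreeOf i p ≠ 0 ∨ degreeOf i q ≠ 0 := by
    rintro (i | i)
    · rfl
    · change degreeOf (Sum.inl i) p ≠ 0 ∨ degreeOf (Sum.inl i) q ≠ 0 ↔ _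
      rw [← hpdeg, ← hqdeg]
      rfl
  have hpt : ∀ i, ¬ t i → degreeOf i p = 0 := fun i hi => by
    rw [ht] at hi; tauto
  have hqt : ∀ i, ¬ t i → degreeOf i q = 0 := fun i hi => by
    rw [ht] at hi; tauto
  have hgt : ∀ i, t i → degreeOf i g = 0 := fun i hi => by
    have h₁ := degreeOf_matrixPoly_le A i
    have h₂ := degreeOf_matrixPoly_le B i
    rw [← hgp, degreeOf_mul_eq hg0 hp0] at h₁
    rw [← hgq, degreeOf_mul_eq hg0 hq0] at h₂
    rw [ht] at hi
    omega
  let e := Equiv.piEquivPiSubtypeProd s fun _ => Fin 2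
  have hfilter : ∀ b k, (bitExponent b k).filter t =
      bitExponent (e.symm ((e b).1, 0)) (e.symm ((e k).1, 0)) := fun b k => by
    ext (i | i) <;> by_cases hi : s i <;>
      simp [Finsupp.filter_apply, t, e, hi]
  have hfilter' : ∀ b k, (bitExponent b k).filter (fun i => ¬ t i) =
      bitExponent (e.symm (0, (e b).2)) (e.symm (0, (e k).2)) := fun b k => by
    ext (i | i) <;> by_cases hi : s i <;>
      simp [t, e, hi]
  refine ⟨s, inferInstance,
    Matrix.of fun b k => coeff (bitExponent (e.symm (b, 0)) (e.symm (k, 0))) p,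
    Matrix.of fun b k => coeff (bitExponent (e.symm (b, 0)) (e.symm (k, 0))) q,
    Matrix.of fun b k => coeff (bitExponent (e.symm (0, b)) (e.symm (0, k))) g,
    c, ?_, ?_, ?_⟩
  · ext b k
    rw [Matrix.conjTranspose_apply, Matrix.smul_apply, Matrix.of_apply, Matrix.of_apply,
      ← coeff_bitExponent_conjSwap, hpc, coeff_C_mul, smul_eq_mul]
  · ext b k
    rw [← coeff_matrixPoly A, ← hgp, mul_comm, coeff_mul_of_disjoint_variables t hpt hgt,
      hfilter, hfilter']
    rfl
  · ext b k
    rw [← coeff_matrixPoly B, ← hgq, mul_comm, coeff_mul_of_disjoint_variables t hqt hgt,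
      hfilter, hfilter']
    rfl

/-- Matrices whose expectations in product vectors have a real ratio satisfy `A Bᴴ = 0` as soon
as `A` squares to zero and commutes with `Bᴴ`. -/
theorem mul_conjTranspose_eq_zero_of_real_ratio {A B : Matrix (ι → Fin 2) (ι → Fin 2) ℂ}
    (h : ∀ z : ι → ℂ,
      (star (productVector z) ⬝ᵥ (A *ᵥ productVector z)) *
          (star (productVector z) ⬝ᵥ (Bᴴ *ᵥ productVector z)) =
        (star (productVector z) ⬝ᵥ (Aᴴ *ᵥ productVector z)) *
          (star (productVector z) ⬝ᵥ (B *ᵥ productVector z)))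
    (hsq : A * A = 0) (hcomm : A * Bᴴ = Bᴴ * A) : A * Bᴴ = 0 := by
  rcases eq_or_ne A 0 with rfl | hA
  · exact zero_mul _
  rcases eq_or_ne B 0 with rfl | hB
  · rw [Matrix.conjTranspose_zero, mul_zero]
  obtain ⟨s, _, P, Q, G, c, hP, rfl, rfl⟩ := exists_kronecker_of_real_ratio hA hB h
  have hinj {M N : Matrix (({i // s i} → Fin 2) × ({i // ¬ s i} → Fin 2))
      (({i // s i} → Fin 2) × ({i // ¬ s i} → Fin 2)) ℂ}
      (hMN : M.submatrix (Equiv.piEquivPiSubtypeProd s fun _ => Fin 2)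
        (Equiv.piEquivPiSubtypeProd s fun _ => Fin 2) =
        N.submatrix (Equiv.piEquivPiSubtypeProd s fun _ => Fin 2)
        (Equiv.piEquivPiSubtypeProd s fun _ => Fin 2)) : M = N :=
    (Matrix.reindex (Equiv.piEquivPiSubtypeProd s fun _ => Fin 2).symm
      (Equiv.piEquivPiSubtypeProd s fun _ => Fin 2).symm).injective hMN
  simp only [Matrix.conjTranspose_submatrix, Matrix.submatrix_mul_equiv] at hsq hcomm ⊢
  rw [kronecker_mul_conjTranspose_eq_zero hP (hinj hsq) (hinj hcomm)]
  rfl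

end MatrixPolynomial

/-! ### Phases as expectations of lowering operators -/

theorem blochXY_of_isHermitian {ρ : QubitOp} (hρ : ρ.IsHermitian) :
    blochXY ρ = !₂[2 * (ρ 0 1).re, -2 * (ρ 0 1).im] := by
  have h : ρ 1 0 = star (ρ 0 1) := (hρ.apply 1 0).symm
  ext i
  fin_cases i <;>
    simp [blochXY, blochVector, pauli, Matrix.trace_fin_two, h, Matrix.mul_apply] <;> ring

/-- If the phase fidelity of two states is `1` or undefined, then the ratio of their coherences
is real or undefined. -/
theorem coherence_mul_star_comm {ρ₁ ρ₂ : QubitOp} (h₁ : ρ₁.IsHermitian) (h₂ : ρ₂.IsHermitian)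
    (h : PhaseDefined ρ₁ ρ₂ → phaseFidelity ρ₁ ρ₂ = 1) :
    ρ₁ 0 1 * star (ρ₂ 0 1) = star (ρ₁ 0 1) * ρ₂ 0 1 := by
  have key : (ρ₁ 0 1).re * (ρ₂ 0 1).im = (ρ₁ 0 1).im * (ρ₂ 0 1).re := by
    by_cases hd : PhaseDefined ρ₁ ρ₂
    · obtain ⟨-, r, -, hr⟩ := (real_inner_div_norm_mul_norm_eq_one_iff _ _).1 (h hd)
      rw [blochXY_of_isHermitian h₁, blochXY_of_isHermitian h₂] at hr
      have h0 := congrArg (· 0) hr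
      have h1 := congrArg (· 1) hr
      simp at h0 h1
      linear_combination (ρ₁ 0 1).re / 2 * h1 - (ρ₁ 0 1).im / 2 * h0
    · have : blochXY ρ₁ = 0 ∨ blochXY ρ₂ = 0 := by
        simpa only [PhaseDefined, not_and_or, not_not, norm_eq_zero] using hd
      rw [blochXY_of_isHermitian h₁, blochXY_of_isHermitian h₂] at this
      rcases this with h' | h'
      all_goals
        have h0 := congrArg (· 0) h'
        have h1 := congrArg (· 1) h'
        simp at h0 h1
        simp [h0, h1]
  apply Complex.ext
  · simp
  · simp; linarith

/-- The lowering operator `|1⟩⟨0|`; its expectation is the coherence `ρ₀₁`. -/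
def lowering : QubitOp := !![0, 0; 1, 0]

theorem lowering_mul_self : lowering * lowering = 0 := by
  ext i j
  fin_cases i <;> fin_cases j <;> simp [lowering]

theorem isHermitian_reduced₁ {ρ : TwoQubitOp} (hρ : ρ.IsHermitian) :
    (reduced₁ ρ).IsHermitian := by
  ext i j
  simp [reduced₁, hρ.apply]

theorem isHermitian_reduced₂ {ρ : TwoQubitOp} (hρ : ρ.IsHermitian) :
    (reduced₂ ρ).IsHermitian := by
  ext i j
  simp [reduced₂, hρ.apply]

theorem conjMap_vecMulVec (U : TwoQubitOp) (w : Fin 2 × Fin 2 → ℂ) :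
    conjMap U (Matrix.vecMulVec w (star w)) =
      Matrix.vecMulVec (U *ᵥ w) (star (U *ᵥ w)) := by
  change U * _ * Uᴴ = _
  rw [Matrix.mul_vecMulVec, Matrix.vecMulVec_mul, Matrix.star_mulVec]

theorem reduced₁_conjMap (U : TwoQubitOp) (w : Fin 2 × Fin 2 → ℂ) :
    reduced₁ (conjMap U (Matrix.vecMulVec w (star w))) 0 1 =
      star w ⬝ᵥ ((Uᴴ * (lowering ⊗ₖ 1) * U) *ᵥ w) := by
  rw [conjMap_vecMulVec, ← Matrix.mulVec_mulVec, ← Matrix.mulVec_mulVec, Matrix.dotProduct_mulVec,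
    ← Matrix.star_mulVec]
  generalize U *ᵥ w = u
  simp [reduced₁, Matrix.vecMulVec_apply, dotProduct, Matrix.mulVec, Fintype.sum_prod_type,
    lowering, Matrix.one_apply, mul_comm]

theorem reduced₂_conjMap (U : TwoQubitOp) (w : Fin 2 × Fin 2 → ℂ) :
    reduced₂ (conjMap U (Matrix.vecMulVec w (star w))) 0 1 =
      star w ⬝ᵥ ((Uᴴ * (1 ⊗ₖ lowering) * U) *ᵥ w) := by
  rw [conjMap_vecMulVec, ← Matrix.mulVec_mulVec, ← Matrix.mulVec_mulVec, Matrix.dotProduct_mulVec,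
    ← Matrix.star_mulVec]
  generalize U *ᵥ w = u
  simp [reduced₂, Matrix.vecMulVec_apply, dotProduct, Matrix.mulVec, Fintype.sum_prod_type,
    lowering, Matrix.one_apply, mul_comm]

/-! ### Product states -/

/-- Every vector `|0⟩ + z |1⟩` spans a pure state. -/
theorem exists_isPureState_smul (z : ℂ) :
    ∃ r : ℝ, r ≠ 0 ∧ IsPureState ((r : ℂ) • Matrix.vecMulVec ![1, z] (star ![1, z])) := by
  have hpos : 0 < 1 + Complex.normSq z := by linarith [Complex.normSq_nonneg z]
  have hs : √(1 + Complex.normSq z) ≠ 0 := (Real.sqrt_pos.2 hpos).ne'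
  have hsq : ((√(1 + Complex.normSq z) : ℝ) : ℂ) * (√(1 + Complex.normSq z) : ℝ) =
      1 + z * star z := by
    rw [← Complex.ofReal_mul, Real.mul_self_sqrt hpos.le, Complex.star_def, Complex.mul_conj]
    simp
  refine ⟨(√(1 + Complex.normSq z))⁻¹ * (√(1 + Complex.normSq z))⁻¹,
    mul_ne_zero (inv_ne_zero hs) (inv_ne_zero hs),
    (((√(1 + Complex.normSq z))⁻¹ : ℝ) : ℂ) • ![1, z], ?_, ?_⟩
  · have hs' : ((√(1 + Complex.normSq z) : ℝ) : ℂ) ≠ 0 := Complex.ofReal_ne_zero.2 hs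
    simp [dotProduct, Fin.sum_univ_two] at hsq ⊢
    field_simp
    linear_combination -hsq
  · rw [star_smul, Matrix.smul_vecMulVec, Matrix.vecMulVec_smul, smul_smul]
    simp

theorem vecMulVec_kronecker_vecMulVec (z : Fin 2 → ℂ) :
    Matrix.vecMulVec ![1, z 0] (star ![1, z 0]) ⊗ₖ Matrix.vecMulVec ![1, z 1] (star ![1, z 1]) =
      Matrix.vecMulVec (productVector z ∘ (finTwoArrowEquiv (Fin 2)).symm)
        (star (productVector z ∘ (finTwoArrowEquiv (Fin 2)).symm)) := by
  have h : ∀ (z : ℂ) (i : Fin 2), ![1, z] i = z ^ (i : ℕ) := fun z i => by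
    fin_cases i <;> simp
  ext ⟨i, j⟩ ⟨k, l⟩
  simp only [Matrix.kroneckerMap_apply, Matrix.vecMulVec_apply, Pi.star_apply, h,
    Function.comp_apply, productVector, Fin.prod_univ_two, finTwoArrowEquiv_symm_apply]
  simp
  ring

theorem dotProduct_submatrix_mulVec {m n : Type*} [Fintype m] [Fintype n] (e : n ≃ m)
    (M : Matrix m m ℂ) (v : n → ℂ) :
    star v ⬝ᵥ (M.submatrix e e *ᵥ v) = star (v ∘ e.symm) ⬝ᵥ (M *ᵥ (v ∘ e.symm)) := by
  rw [Matrix.submatrix_mulVec_equiv, ← comp_equiv_symm_dotProduct]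
  rfl

/-- Perfect synchronization makes the ratio of the two coherences real on product vectors. -/
theorem PerfectQPS.real_ratio {U : Matrix.unitaryGroup (Fin 2 × Fin 2) ℂ} {V : TwoQubitOp}
    (hV : V = U) (h : PerfectQPS (unitaryChannel U) pureProductStates) (z : Fin 2 → ℂ)
    {w : Fin 2 × Fin 2 → ℂ} (hw : w = productVector z ∘ (finTwoArrowEquiv (Fin 2)).symm) :
    (star w ⬝ᵥ ((Vᴴ * (lowering ⊗ₖ 1) * V) *ᵥ w)) *
        star (star w ⬝ᵥ ((Vᴴ * (1 ⊗ₖ lowering) * V) *ᵥ w)) =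
      star (star w ⬝ᵥ ((Vᴴ * (lowering ⊗ₖ 1) * V) *ᵥ w)) *
        (star w ⬝ᵥ ((Vᴴ * (1 ⊗ₖ lowering) * V) *ᵥ w)) := by
  obtain ⟨r₁, hr₁, hp₁⟩ := exists_isPureState_smul (z 0)
  obtain ⟨r₂, hr₂, hp₂⟩ := exists_isPureState_smul (z 1)
  have hF := h _ ⟨_, _, hp₁, hp₂, rfl⟩
  rw [Matrix.smul_kronecker, Matrix.kronecker_smul, smul_smul, vecMulVec_kronecker_vecMulVec,
    ← hw] at hF
  have hherm : ((unitaryChannel U).toFun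
      (((r₁ : ℂ) * r₂) • Matrix.vecMulVec w (star w))).IsHermitian := by
    change (conjMap U _).IsHermitian
    rw [map_smul, conjMap_vecMulVec]
    ext i j
    simp [Matrix.vecMulVec_apply, mul_comm]
  have key := coherence_mul_star_comm (isHermitian_reduced₁ hherm) (isHermitian_reduced₂ hherm) hF
  have e₁ : ∀ (a : ℂ) (X : TwoQubitOp), reduced₁ (a • X) 0 1 = a * reduced₁ X 0 1 :=
    fun a X => by simp [reduced₁, mul_add]
  have e₂ : ∀ (a : ℂ) (X : TwoQubitOp), reduced₂ (a • X) 0 1 = a * reduced₂ X 0 1 :=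
    fun a X => by simp [reduced₂, mul_add]
  rw [map_smul, e₁, e₂] at key
  change _ * reduced₁ (conjMap U _) 0 1 * star (_ * reduced₂ (conjMap U _) 0 1) =
    star (_ * reduced₁ (conjMap U _) 0 1) * (_ * reduced₂ (conjMap U _) 0 1) at key
  rw [← hV, reduced₁_conjMap, reduced₂_conjMap] at key
  have hr : ((r₁ : ℂ) * r₂) ≠ 0 :=
    mul_ne_zero (Complex.ofReal_ne_zero.2 hr₁) (Complex.ofReal_ne_zero.2 hr₂)
  have hr' : star ((r₁ : ℂ) * r₂) = r₁ * r₂ := by simp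
  simp only [star_mul', hr'] at key
  refine mul_left_cancel₀ (mul_ne_zero hr hr) ?_
  linear_combination key

end QPS

theorem theorem1 (U : Matrix.specialUnitaryGroup (Fin 2 × Fin 2) ℂ) :
    ¬ QPS.PerfectQPS
        (QPS.unitaryChannel ⟨U, Matrix.specialUnitaryGroup_le_unitaryGroup U.2⟩)
        QPS.pureProductStates := by
  intro h
  have hU : (U : QPS.TwoQubitOp) * (U : QPS.TwoQubitOp)ᴴ = 1 :=
    Matrix.mem_unitaryGroup_iff.1 (Matrix.specialUnitaryGroup_le_unitaryGroup U.2)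
  have hratio := fun z => h.real_ratio rfl z rfl
  simp only at hratio
  generalize (U : QPS.TwoQubitOp) = V at hU hratio
  have hmul (M N : QPS.TwoQubitOp) : (Vᴴ * M * V) * (Vᴴ * N * V) = Vᴴ * (M * N) * V := by
    calc _ = Vᴴ * M * (V * Vᴴ) * (N * V) := by simp only [mul_assoc]
      _ = _ := by rw [hU, mul_one]; simp only [mul_assoc]
  have hstar (M : QPS.TwoQubitOp) : (Vᴴ * M * V)ᴴ = Vᴴ * Mᴴ * V := by
    simp [Matrix.conjTranspose_mul, mul_assoc]
  -- Both operators are moved to the index type `Fin 2 → Fin 2` of bit strings.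
  have hzero := QPS.mul_conjTranspose_eq_zero_of_real_ratio
    (A := (Vᴴ * (QPS.lowering ⊗ₖ 1) * V).submatrix (finTwoArrowEquiv (Fin 2))
      (finTwoArrowEquiv (Fin 2)))
    (B := (Vᴴ * (1 ⊗ₖ QPS.lowering) * V).submatrix (finTwoArrowEquiv (Fin 2))
      (finTwoArrowEquiv (Fin 2))) ?_ ?_ ?_
  · rw [Matrix.conjTranspose_submatrix, Matrix.submatrix_mul_equiv, hstar, hmul,
      Matrix.conjTranspose_kronecker, ← Matrix.mul_kronecker_mul, Matrix.conjTranspose_one,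
      one_mul, mul_one] at hzero
    have h0 : Vᴴ * (QPS.lowering ⊗ₖ QPS.loweringᴴ) * V = 0 :=
      (Matrix.reindex (finTwoArrowEquiv (Fin 2)).symm (finTwoArrowEquiv (Fin 2)).symm).injective
        hzero
    have h1 : QPS.lowering ⊗ₖ QPS.loweringᴴ = 0 := by
      calc _ = (V * Vᴴ) * (QPS.lowering ⊗ₖ QPS.loweringᴴ) * (V * Vᴴ) := by
            rw [hU, one_mul, mul_one]
        _ = V * (Vᴴ * (QPS.lowering ⊗ₖ QPS.loweringᴴ) * V) * Vᴴ := by simp only [mul_assoc]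
        _ = 0 := by rw [h0, mul_zero, zero_mul]
    have h2 := congrFun (congrFun h1 (1, 0)) (0, 1)
    simp [QPS.lowering] at h2
  · intro z
    simp only [Matrix.conjTranspose_submatrix, QPS.dotProduct_submatrix_mulVec]
    have hadj (M : QPS.TwoQubitOp) (w : Fin 2 × Fin 2 → ℂ) :
        star w ⬝ᵥ (Mᴴ *ᵥ w) = star (star w ⬝ᵥ (M *ᵥ w)) := by
      rw [Matrix.star_dotProduct, Matrix.star_mulVec, Matrix.conjTranspose_conjTranspose,
        ← Matrix.dotProduct_mulVec]
    rw [hadj, hadj]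
    exact hratio z
  · rw [Matrix.submatrix_mul_equiv, hmul, ← Matrix.mul_kronecker_mul, QPS.lowering_mul_self,
      Matrix.zero_kronecker, mul_zero, zero_mul]
    rfl
  · simp only [Matrix.conjTranspose_submatrix, Matrix.submatrix_mul_equiv, hstar, hmul,
      Matrix.conjTranspose_kronecker, ← Matrix.mul_kronecker_mul, Matrix.conjTranspose_one,
      one_mul, mul_one]
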